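/- Let $m$ be normalized Lebesgue measure on the unit circle $\mathbb T$, let $\chi(\zeta)=\zeta$ and $\mathbf 1(\zeta)=1$, and let $H^2$ be the Hardy space of the unit disk $\mathbb D$, identified through boundary values with the subspace of $L^2(\mathbb T,m)$ of the functions whose Fourier coefficients of negative index vanish; $(\cdot,\cdot)$ is the inner product of $L^2(\mathbb T,m)$, linear in the first argument. For an inner function $\theta$ put $\mathcal K_\theta=H^2\ominus\theta H^2$ and let $S_\theta f=P_{\mathcal K_\theta}(\chi f)$, $f\in\mathcal K_\theta$, where $P_{\mathcal K_\theta}$ is the orthogonal projection onto $\mathcal K_\theta$. If $\theta(0)=0$, then $\mathbf 1,\overline\chi\theta\in\mathcal K_\theta$; put $U_{(\theta)1}=S_\theta+(\cdot,\overline\chi\theta)\mathbf 1$. **Theorem.** Let $\theta,\omega$ be inner functions with $\theta(0)=\omega(0)=0$, let $u\in\mathcal K_\omega$, and let $$T=S_\omega+(\cdot,\overline\chi\omega)u$$ on $\mathcal K_\omega$. Let $X:\mathcal K_\theta\to\mathcal K_\omega$ be a bounded linear operator such that $$X^*(\overline\chi\omega)=\overline\chi\theta\qquad\text{and}\qquad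 XU_{(\theta)1}=TX .$$ Then $\theta\neq1$ everywhere on $\mathbb D$ and $m$-a.e. on $\mathbb T$; the function $$g=\frac{u-\omega}{1-\theta}$$ (formed pointwise on $\mathbb D$, and $m$-a.e. on $\mathbb T$ from boundary values) belongs to $\mathcal K_\omega$; and $Xf=gf$ for every $f\in\mathcal K_\theta$, both on $\mathbb D$ and $m$-a.e. on $\mathbb T$. In particular $g$ is a multiplier between $\mathcal K_\theta$ and $\mathcal K_\omega$, that is, $g\in H^2$ and $gf\in\mathcal K_\omega$ for every $f\in\mathcal K_\theta$. -/

import Mathlib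

open MeasureTheory

noncomputable section

namespace ModelSpaces

/-- `L²(𝕋, m)`, where the unit circle `𝕋` is parametrised by `ℝ / ℤ` through
`t ↦ e^{2πit}` and `m` is the normalised Lebesgue measure.  The function `fourier n` on `ℝ / ℤ`
is the function `χⁿ` on `𝕋`, where `χ(ζ) = ζ`. -/
abbrev L2T : Type := Lp ℂ 2 (AddCircle.haarAddCircle : Measure UnitAddCircle)

/-- Multiplication by `χⁿ` (`n ∈ ℤ`) on `L²(𝕋, m)`; `n = 1` is multiplication by `χ`, and
`n = -1` is multiplication by its conjugate. -/
def mulChi (n : ℤ) : L2T →L[ℂ] L2T :=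
  (ContinuousLinearMap.mul ℂ ℂ).holderL AddCircle.haarAddCircle ⊤ 2 2 (fourierLp ⊤ n)

theorem coeFn_mulChi (n : ℤ) (f : L2T) :
    ∀ᵐ t ∂(AddCircle.haarAddCircle : Measure UnitAddCircle),
      (mulChi n f : UnitAddCircle → ℂ) t = fourier n t * f t := by
  have h1 := (ContinuousLinearMap.mul ℂ ℂ).coeFn_holder (r := 2)
    (fourierLp (T := 1) ⊤ n) f
  filter_upwards [h1, coeFn_fourierLp (T := 1) ⊤ n] with t h1 h2
  rw [← h2]
  exact h1

/-- The constant function `1` on `𝕋`. -/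
def one : L2T := fourierLp 2 0

/-- The Hardy space `H²`, identified through boundary values with the subspace of
`L²(𝕋, m)` of the functions whose Fourier coefficients of negative index vanish. -/
def H2 : Submodule ℂ L2T where
  carrier := {f | ∀ n : ℤ, n < 0 → fourierCoeff f n = 0}
  zero_mem' := fun n _ => by
    rw [← fourierBasis_repr, map_zero]; rfl
  add_mem' := fun {f g} hf hg n hn => by
    have h1 := hf n hn
    have h2 := hg n hn
    rw [← fourierBasis_repr] at h1 h2 ⊢
    rw [map_add, lp.coeFn_add, Pi.add_apply, h1, h2, add_zero]
  smul_mem' := fun c f hf n hn => by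
    have h1 := hf n hn
    rw [← fourierBasis_repr] at h1 ⊢
    rw [map_smul, lp.coeFn_smul, Pi.smul_apply, h1, smul_zero]

theorem mem_H2 {f : L2T} : f ∈ H2 ↔ ∀ n : ℤ, n < 0 → fourierCoeff f n = 0 := Iff.rfl

theorem fourierCoeff_eq_inner (f : L2T) (n : ℤ) :
    fourierCoeff f n = inner ℂ (fourierLp 2 n : L2T) f := by
  rw [← fourierBasis_repr, HilbertBasis.repr_apply_apply, coe_fourierBasis]

theorem isClosed_H2 : IsClosed (H2 : Set L2T) := by
  have : (H2 : Set L2T) = ⋂ n : ℤ, ⋂ _ : n < 0,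
      {f : L2T | inner ℂ (fourierLp 2 n : L2T) f = 0} := by
    ext f
    simp [mem_H2, fourierCoeff_eq_inner]
  rw [this]
  refine isClosed_iInter fun n => isClosed_iInter fun _ => ?_
  exact isClosed_eq (by fun_prop) continuous_const

/-- The value `f(z) = ∑_{n ≥ 0} \hat f(n) zⁿ` at `z`, `|z| < 1`, of the analytic function in the
unit disk whose boundary function is `f ∈ H²`. -/
def diskValue (f : L2T) (z : ℂ) : ℂ := ∑' n : ℕ, fourierCoeff f (n : ℤ) * z ^ n

theorem diskValue_zero (f : L2T) : diskValue f 0 = fourierCoeff f 0 := by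
  rw [diskValue, tsum_eq_single 0]
  · simp
  · intro n hn
    simp [hn]

/-- `θ` is an inner function: it belongs to `H²` and `|θ| = 1` a.e. on `𝕋`
(so that `θ ∈ H^∞`). -/
structure IsInner (θ : L2T) : Prop where
  mem_H2 : θ ∈ H2
  norm_eq_one : ∀ᵐ t ∂(AddCircle.haarAddCircle : Measure UnitAddCircle), ‖θ t‖ = 1

/-- `θH²`: the functions of `L²(𝕋, m)` of the form `θh` with `h ∈ H²`. -/
def mulH2 (θ : L2T) : Submodule ℂ L2T where
  carrier := {k | ∃ h ∈ H2, ∀ᵐ t ∂(AddCircle.haarAddCircle : Measure UnitAddCircle),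
    k t = θ t * h t}
  zero_mem' := ⟨0, H2.zero_mem, by
    filter_upwards [Lp.coeFn_zero ℂ 2 (AddCircle.haarAddCircle : Measure UnitAddCircle)] with t h
    rw [h, Pi.zero_apply, mul_zero]⟩
  add_mem' := by
    rintro k₁ k₂ ⟨h₁, m₁, e₁⟩ ⟨h₂, m₂, e₂⟩
    refine ⟨h₁ + h₂, H2.add_mem m₁ m₂, ?_⟩
    filter_upwards [e₁, e₂, Lp.coeFn_add k₁ k₂, Lp.coeFn_add h₁ h₂] with t a b c d
    rw [c, d, Pi.add_apply, Pi.add_apply, a, b, mul_add]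
  smul_mem' := by
    rintro c k ⟨h, m, e⟩
    refine ⟨c • h, H2.smul_mem c m, ?_⟩
    filter_upwards [e, Lp.coeFn_smul c k, Lp.coeFn_smul c h] with t a b d
    rw [b, d, Pi.smul_apply, Pi.smul_apply, a, smul_eq_mul, smul_eq_mul]
    ring

/-- The model space `K_θ = H² ⊖ θH²`. -/
def modelSpace (θ : L2T) : Submodule ℂ L2T := H2 ⊓ (mulH2 θ)ᗮ

instance (θ : L2T) : CompleteSpace (modelSpace θ) :=
  IsClosed.completeSpace_coe (hs := isClosed_H2.inter (mulH2 θ).isClosed_orthogonal)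

/-- The compressed shift `S_θ = P_{K_θ} S|_{K_θ}`, where `S` is multiplication by `χ`. -/
def compressedShift (θ : L2T) : modelSpace θ →L[ℂ] modelSpace θ :=
  (modelSpace θ).orthogonalProjectionOnto ∘L mulChi 1 ∘L (modelSpace θ).subtypeL

/-- `g ∈ H²` is a multiplier between `K_θ` and `K_ω`: `gf ∈ K_ω` for every `f ∈ K_θ`. -/
def IsMultiplier (θ ω g : L2T) : Prop :=
  g ∈ H2 ∧ ∀ f ∈ modelSpace θ, ∃ k ∈ modelSpace ω,
    ∀ᵐ t ∂(AddCircle.haarAddCircle : Measure UnitAddCircle), k t = g t * f t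

theorem fourierCoeff_mulChi (n : ℤ) (f : L2T) (k : ℤ) :
    fourierCoeff (mulChi n f) k = fourierCoeff f (k - n) := by
  unfold fourierCoeff
  refine integral_congr_ae ?_
  filter_upwards [coeFn_mulChi n f] with t h
  rw [h, smul_eq_mul, smul_eq_mul, ← mul_assoc, ← fourier_add]
  congr 3
  ring

theorem coeFn_one : ∀ᵐ t ∂(AddCircle.haarAddCircle : Measure UnitAddCircle),
    (one : UnitAddCircle → ℂ) t = 1 := by
  filter_upwards [coeFn_fourierLp (T := 1) 2 0] with t h
  rw [one, h, fourier_zero]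

/-- `1 ∈ K_θ` if `θ(0) = 0`. -/
theorem one_mem {θ : L2T} (hθ : IsInner θ) (h0 : diskValue θ 0 = 0) : one ∈ modelSpace θ := by
  rw [diskValue_zero] at h0
  refine ⟨fun n hn => ?_, ?_⟩
  · rw [fourierCoeff_eq_inner, one]
    exact orthonormal_fourier.2 hn.ne
  · refine (Submodule.mem_orthogonal' _ _).2 ?_
    rintro k ⟨h, hh, e⟩
    have h1 : inner ℂ one k = inner ℂ (star θ) h := by
      rw [L2.inner_def, L2.inner_def]
      refine integral_congr_ae ?_
      filter_upwards [e, coeFn_one, Lp.coeFn_star θ] with t a b c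
      simp [a, b, c, mul_comm]
    have h2 : ∀ n : ℤ, inner ℂ (star θ) (fourierLp 2 n : L2T) = fourierCoeff θ (-n) := by
      intro n
      rw [L2.inner_def, fourierCoeff]
      refine integral_congr_ae ?_
      filter_upwards [coeFn_fourierLp (T := 1) 2 n, Lp.coeFn_star θ] with t b c
      rw [RCLike.inner_apply, b, c, Pi.star_apply, starRingEnd_apply, star_star, neg_neg,
        smul_eq_mul]
    rw [h1, ← (fourierBasis (T := 1)).tsum_inner_mul_inner (star θ) h]
    refine (tsum_congr fun n => ?_).trans tsum_zero
    rw [coe_fourierBasis, h2, ← fourierCoeff_eq_inner]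
    rcases lt_trichotomy n 0 with hn | rfl | hn
    · rw [hh n hn, mul_zero]
    · rw [neg_zero, h0, zero_mul]
    · rw [hθ.mem_H2 (-n) (by omega), zero_mul]

/-- `χ̄θ ∈ K_θ` if `θ(0) = 0`. -/
theorem conjChi_mem {θ : L2T} (hθ : IsInner θ) (h0 : diskValue θ 0 = 0) :
    mulChi (-1) θ ∈ modelSpace θ := by
  rw [diskValue_zero] at h0
  refine ⟨fun n hn => ?_, ?_⟩
  · rw [fourierCoeff_mulChi]
    rcases (show n - -1 < 0 ∨ n - -1 = 0 by omega) with h | h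
    · exact hθ.mem_H2 _ h
    · rw [h, h0]
  · refine (Submodule.mem_orthogonal' _ _).2 ?_
    rintro k ⟨h, hh, e⟩
    have h1 : inner ℂ (mulChi (-1) θ) k = fourierCoeff h (-1) := by
      rw [L2.inner_def, fourierCoeff]
      refine integral_congr_ae ?_
      filter_upwards [e, coeFn_mulChi (-1) θ, hθ.norm_eq_one] with t a b c
      have hc : θ t * (starRingEnd ℂ) (θ t) = 1 := by
        rw [Complex.mul_conj, Complex.normSq_eq_norm_sq, c]; simp
      simp only [RCLike.inner_apply, a, b, map_mul, ← fourier_neg, smul_eq_mul]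
      linear_combination (fourier (- -1) t * h t) * hc
    rw [h1]
    exact hh (-1) (by norm_num)

/-- The constant function `1` as an element of `K_θ`. -/
def oneElt {θ : L2T} (hθ : IsInner θ) (h0 : diskValue θ 0 = 0) : modelSpace θ :=
  ⟨one, one_mem hθ h0⟩

/-- The function `χ̄θ` as an element of `K_θ`. -/
def conjChiElt {θ : L2T} (hθ : IsInner θ) (h0 : diskValue θ 0 = 0) : modelSpace θ :=
  ⟨mulChi (-1) θ, conjChi_mem hθ h0⟩

/-- `S_θ + (·, χ̄θ)u` for `u ∈ K_θ`; the rank one operator is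
`f ↦ (f, χ̄θ)u`. -/
def perturbedShift {θ : L2T} (hθ : IsInner θ) (h0 : diskValue θ 0 = 0) (u : modelSpace θ) :
    modelSpace θ →L[ℂ] modelSpace θ :=
  compressedShift θ + InnerProductSpace.rankOne ℂ u (conjChiElt hθ h0)

/-- The unitary operator `U_{(θ)c} = S_θ + c(·, χ̄θ)1`, `|c| = 1`. -/
def clarkUnitary {θ : L2T} (hθ : IsInner θ) (h0 : diskValue θ 0 = 0) (c : Circle) :
    modelSpace θ →L[ℂ] modelSpace θ :=
  compressedShift θ +
    (c : ℂ) • InnerProductSpace.rankOne ℂ (oneElt hθ h0) (conjChiElt hθ h0)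

end ModelSpaces

end

open MeasureTheory

noncomputable section

namespace ModelSpaces

/-! Since `S_ω f = χf - (f, χ̄ω)ω`, one has `Tf = χf + (f, χ̄ω)(u - ω)`, so at a point `z` of the
disk the value of `(T - z)f` is `(f, χ̄ω)(u(z) - ω(z))`. Likewise `(U - z)f` has the value `(f,
χ̄θ)(1 - θ(z))`, where `U = U_{(θ)1}`. As `U` is unitary, `U - z` is onto and each `h ∈ K_θ` is some
`(U - z)f`. Then `Xh = (T - z)Xf`, and the condition on `X*` gives `(Xf, χ̄ω) = (f, χ̄θ)`.
Eliminating this scalar yields `(1 - θ)Xh = (u - ω)h` in the disk (`one_sub_mul_diskValue_apply`).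
The same surjectivity applied to `h = 1` shows `θ(z) ≠ 1`, and the identity for `h = 1` shows `g =
X1`.

On the circle, both sides of the identity are products of `H²` functions, hence integrable with
Cauchy-product coefficients. Uniqueness of Fourier coefficients in `L¹` carries the identity to the
boundary (`mul_ae_eq_mul_of_diskValue`). Division by `1 - θ` is allowed there because the powers of
`θ` are orthonormal, and Bessel's inequality makes `{θ = 1}` null (`IsInner.ae_ne_one`). -/

/-! ### Fourier coefficients and uniqueness -/

/-- An integrable function on the circle all of whose Fourier coefficients vanish is zero. -/
theorem ae_eq_zero_of_fourierCoeff_eq_zero {F : UnitAddCircle → ℂ}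
    (hF : Integrable F AddCircle.haarAddCircle) (h : ∀ n : ℤ, fourierCoeff F n = 0) :
    F =ᵐ[AddCircle.haarAddCircle] 0 := by
  have hint : ∀ φ : C(UnitAddCircle, ℂ), Integrable (fun t => φ t * F t)
      AddCircle.haarAddCircle := fun φ =>
    hF.bdd_mul φ.continuous.aestronglyMeasurable (c := ‖φ‖)
      (Filter.Eventually.of_forall fun t => φ.norm_coe_le_norm t)
  let Λ : C(UnitAddCircle, ℂ) →L[ℂ] ℂ := LinearMap.mkContinuous
    { toFun := fun φ => ∫ t, φ t * F t ∂AddCircle.haarAddCircle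
      map_add' := fun φ ψ => by
        rw [← integral_add (hint φ) (hint ψ)]
        simp only [ContinuousMap.add_apply, add_mul]
      map_smul' := fun c φ => by
        rw [RingHom.id_apply, smul_eq_mul, ← integral_const_mul]
        simp only [ContinuousMap.smul_apply, smul_eq_mul, mul_assoc] }
    (∫ t, ‖F t‖ ∂AddCircle.haarAddCircle) (fun φ => by
      refine (norm_integral_le_integral_norm _).trans ?_
      rw [← integral_mul_const]
      refine integral_mono (hint φ).norm (hF.norm.mul_const _) fun t => ?_
      rw [norm_mul, mul_comm]
      exact mul_le_mul_of_nonneg_left (φ.norm_coe_le_norm t) (norm_nonneg _))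
  -- The functional vanishes on trigonometric polynomials, which are dense in `C(𝕋)`, and its kernel
  -- is closed.
  have hΛ : ∀ φ, Λ φ = 0 := by
    have hspan : (Submodule.span ℂ (Set.range (@fourier 1))) ≤ Λ.ker := by
      rw [Submodule.span_le]
      rintro _ ⟨n, rfl⟩
      have := h (-n)
      rw [fourierCoeff, neg_neg] at this
      exact this
    have hcl := Submodule.topologicalClosure_minimal _ hspan Λ.isClosed_ker
    rw [span_fourier_closure_eq_top] at hcl
    exact fun φ => hcl (Submodule.mem_top (x := φ))
  -- The indicator of a closed set is a pointwise limit of continuous functions with values in `[0,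
  -- 1]`, so dominated convergence applies with bound `‖F‖`.
  refine ae_eq_zero_of_forall_setIntegral_isClosed_eq_zero hF fun s hs => ?_
  have hlim : Filter.Tendsto (fun n : ℕ => ∫ t, ((hs.apprSeq n t : NNReal) : ℂ) * F t
      ∂AddCircle.haarAddCircle) Filter.atTop
      (nhds (∫ t, s.indicator F t ∂AddCircle.haarAddCircle)) := by
    refine tendsto_integral_of_dominated_convergence (fun t => ‖F t‖) (fun n => ?_) hF.norm
      (fun n => ?_) ?_
    · refine AEStronglyMeasurable.mul ?_ hF.aestronglyMeasurable
      exact (Complex.continuous_ofReal.comp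
        (NNReal.continuous_coe.comp (hs.apprSeq n).continuous)).aestronglyMeasurable
    · filter_upwards with t
      rw [norm_mul]
      refine mul_le_of_le_one_left (norm_nonneg _) ?_
      rw [Complex.norm_real, NNReal.norm_eq]
      exact_mod_cast HasOuterApproxClosed.apprSeq_apply_le_one hs n t
    · filter_upwards with t
      have h1 := tendsto_pi_nhds.1 (HasOuterApproxClosed.tendsto_apprSeq hs) t
      have h2 := ((Complex.continuous_ofReal.comp NNReal.continuous_coe).tendsto _).comp h1
      have h3 := h2.mul_const (F t)
      refine h3.congr' ?_ |>.trans (le_of_eq ?_)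
      · exact Filter.Eventually.of_forall fun n => rfl
      · by_cases ht : t ∈ s <;> simp [ht]
  rw [← integral_indicator hs.measurableSet]
  refine tendsto_nhds_unique hlim ?_
  refine tendsto_const_nhds.congr fun n => ?_
  exact (hΛ ⟨fun t => ((hs.apprSeq n t : NNReal) : ℂ), Complex.continuous_ofReal.comp
    (NNReal.continuous_coe.comp (hs.apprSeq n).continuous)⟩).symm

/-- The coefficients of a power series are determined by its values in the unit disk. -/
theorem eq_of_tsum_mul_pow_eq {c d : ℕ → ℂ}
    (hc : ∀ z ∈ Metric.ball (0 : ℂ) 1, Summable fun n => ‖c n * z ^ n‖)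
    (hd : ∀ z ∈ Metric.ball (0 : ℂ) 1, Summable fun n => ‖d n * z ^ n‖)
    (h : ∀ z ∈ Metric.ball (0 : ℂ) 1, ∑' n, c n * z ^ n = ∑' n, d n * z ^ n) : c = d := by
  have key : ∀ a : ℕ → ℂ, (∀ z ∈ Metric.ball (0 : ℂ) 1, Summable fun n => ‖a n * z ^ n‖) →
      HasFPowerSeriesAt (fun z => ∑' n, a n * z ^ n)
        (FormalMultilinearSeries.ofScalars ℂ a) 0 := by
    intro a ha
    -- Any radius in `(0, 1)` would do: only the germ at `0` matters.
    refine ⟨((1 / 2 : NNReal) : ENNReal), ?_, by norm_num, ?_⟩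
    · refine FormalMultilinearSeries.le_radius_of_summable_norm _ ?_
      refine (ha (1 / 2) (by norm_num)).congr fun n => ?_
      rw [FormalMultilinearSeries.ofScalars_norm, norm_mul, norm_pow]
      norm_num
    · intro y hy
      have hy' : y ∈ Metric.ball (0 : ℂ) 1 := by
        rw [Metric.mem_eball, edist_zero_right] at hy
        rw [mem_ball_zero_iff]
        have : ‖y‖₊ < 1 / 2 := by exact_mod_cast hy
        have h2 : ‖y‖ < ((1 / 2 : NNReal) : ℝ) := by exact_mod_cast this
        norm_num at h2
        linarith
      rw [zero_add]
      simpa [FormalMultilinearSeries.ofScalars_apply_eq, mul_comm] using (ha y hy').of_norm.hasSum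
  refine FormalMultilinearSeries.ofScalars_series_injective ℂ (E := ℂ) ?_
  refine (key c hc).eq_formalMultilinearSeries_of_eventually (key d hd) ?_
  filter_upwards [Metric.ball_mem_nhds (0 : ℂ) one_pos] with z hz using h z hz

/-! ### Algebra of Fourier coefficients and disk values -/

theorem fourierCoeff_sub (f g : L2T) (n : ℤ) :
    fourierCoeff (f - g : L2T) n = fourierCoeff f n - fourierCoeff g n := by
  simp only [fourierCoeff_eq_inner, inner_sub_right]

theorem fourierCoeff_add (f g : L2T) (n : ℤ) :
    fourierCoeff (f + g : L2T) n = fourierCoeff f n + fourierCoeff g n := by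
  simp only [fourierCoeff_eq_inner, inner_add_right]

theorem fourierCoeff_smul (c : ℂ) (f : L2T) (n : ℤ) :
    fourierCoeff (c • f : L2T) n = c * fourierCoeff f n := by
  simp only [fourierCoeff_eq_inner, inner_smul_right]

theorem fourierCoeff_one (n : ℤ) : fourierCoeff one n = if n = 0 then 1 else 0 := by
  rw [fourierCoeff_eq_inner, one]
  exact orthonormal_iff_ite.1 orthonormal_fourier n 0

theorem norm_fourierCoeff_le (f : L2T) (n : ℤ) : ‖fourierCoeff f n‖ ≤ ‖f‖ := by
  rw [fourierCoeff_eq_inner]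
  refine (norm_inner_le_norm _ _).trans ?_
  rw [orthonormal_fourier.1 n, one_mul]

theorem summable_norm_fourierCoeff_mul_pow (f : L2T) {z : ℂ} (hz : z ∈ Metric.ball (0 : ℂ) 1) :
    Summable fun n : ℕ => ‖fourierCoeff f (n : ℤ) * z ^ n‖ := by
  rw [mem_ball_zero_iff] at hz
  refine Summable.of_nonneg_of_le (fun n => norm_nonneg _) (fun n => ?_)
    ((summable_geometric_of_lt_one (norm_nonneg z) hz).mul_left ‖f‖)
  rw [norm_mul, norm_pow]
  exact mul_le_mul_of_nonneg_right (norm_fourierCoeff_le f n) (by positivity)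

theorem diskValue_sub (f g : L2T) {z : ℂ} (hz : z ∈ Metric.ball (0 : ℂ) 1) :
    diskValue (f - g) z = diskValue f z - diskValue g z := by
  rw [diskValue, diskValue, diskValue,
    ← (summable_norm_fourierCoeff_mul_pow f hz).of_norm.tsum_sub
      (summable_norm_fourierCoeff_mul_pow g hz).of_norm]
  simp only [fourierCoeff_sub, sub_mul]

theorem diskValue_add (f g : L2T) {z : ℂ} (hz : z ∈ Metric.ball (0 : ℂ) 1) :
    diskValue (f + g) z = diskValue f z + diskValue g z := by
  rw [diskValue, diskValue, diskValue,
    ← (summable_norm_fourierCoeff_mul_pow f hz).of_norm.tsum_add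
      (summable_norm_fourierCoeff_mul_pow g hz).of_norm]
  simp only [fourierCoeff_add, add_mul]

theorem diskValue_smul (c : ℂ) (f : L2T) (z : ℂ) :
    diskValue (c • f) z = c * diskValue f z := by
  rw [diskValue, diskValue, ← tsum_mul_left]
  simp only [fourierCoeff_smul, mul_assoc]

theorem diskValue_one (z : ℂ) : diskValue one z = 1 := by
  rw [diskValue, tsum_eq_single 0]
  · simp [fourierCoeff_one]
  · intro n hn
    simp [fourierCoeff_one, hn]

theorem diskValue_mulChi_one {f : L2T} (hf : f ∈ H2) {z : ℂ} (hz : z ∈ Metric.ball (0 : ℂ) 1) :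
    diskValue (mulChi 1 f) z = z * diskValue f z := by
  rw [diskValue, (summable_norm_fourierCoeff_mul_pow (mulChi 1 f) hz).of_norm.tsum_eq_zero_add,
    diskValue, ← tsum_mul_left]
  simp only [fourierCoeff_mulChi]
  rw [Nat.cast_zero, zero_sub, hf (-1) (by norm_num), zero_mul, zero_add]
  refine tsum_congr fun n => ?_
  rw [Nat.cast_add, Nat.cast_one, add_sub_cancel_right, pow_succ]
  ring

/-! ### Products of functions in `H²` -/

theorem inner_star_fourierLp (f : L2T) (n : ℤ) :
    inner ℂ (star f) (fourierLp 2 n : L2T) = fourierCoeff f (-n) := by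
  rw [L2.inner_def, fourierCoeff]
  refine integral_congr_ae ?_
  filter_upwards [coeFn_fourierLp (T := 1) 2 n, Lp.coeFn_star f] with t b c
  rw [RCLike.inner_apply, b, c, Pi.star_apply, starRingEnd_apply, star_star, neg_neg,
    smul_eq_mul]

/-- Parseval's identity for the pairing of `f̄` with `χ⁻ⁿg`. -/
theorem fourierCoeff_mul (f g : L2T) (n : ℤ) :
    fourierCoeff (fun t => f t * g t) n =
      ∑' k : ℤ, fourierCoeff f (-k) * fourierCoeff g (n + k) := by
  have h1 : fourierCoeff (fun t => f t * g t) n = inner ℂ (star f) (mulChi (-n) g) := by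
    rw [L2.inner_def, fourierCoeff]
    refine integral_congr_ae ?_
    filter_upwards [coeFn_mulChi (-n) g, Lp.coeFn_star f] with t b c
    rw [RCLike.inner_apply, b, c, Pi.star_apply, starRingEnd_apply, star_star, smul_eq_mul]
    ring
  rw [h1, ← (fourierBasis (T := 1)).tsum_inner_mul_inner]
  refine tsum_congr fun k => ?_
  rw [coe_fourierBasis, inner_star_fourierLp, ← fourierCoeff_eq_inner, fourierCoeff_mulChi]
  congr 2
  ring

theorem fourierCoeff_mul_of_neg {f g : L2T} (hf : f ∈ H2) (hg : g ∈ H2) {n : ℤ} (hn : n < 0) :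
    fourierCoeff (fun t => f t * g t) n = 0 := by
  rw [fourierCoeff_mul]
  refine (tsum_congr fun k => ?_).trans tsum_zero
  rcases lt_or_ge 0 k with hk | hk
  · rw [hf (-k) (by omega), zero_mul]
  · rw [hg (n + k) (by omega), mul_zero]

theorem fourierCoeff_mul_natCast {f g : L2T} (hf : f ∈ H2) (hg : g ∈ H2) (n : ℕ) :
    fourierCoeff (fun t => f t * g t) (n : ℤ) =
      ∑ k ∈ Finset.range (n + 1), fourierCoeff f (k : ℤ) * fourierCoeff g ((n - k : ℕ) : ℤ) := by
  have hinj : Function.Injective fun k : ℕ => -(k : ℤ) := fun a b h => by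
    simpa using h
  -- Terms with positive index vanish because `f ∈ H²`; the others are reindexed by `k ↦ -k`.
  rw [fourierCoeff_mul, ← hinj.tsum_eq]
  · rw [tsum_eq_sum (s := Finset.range (n + 1))]
    · refine Finset.sum_congr rfl fun k hk => ?_
      rw [Finset.mem_range] at hk
      rw [neg_neg, Nat.cast_sub (by omega), sub_eq_add_neg]
    · intro k hk
      rw [Finset.mem_range] at hk
      rw [hg _ (by omega), mul_zero]
  · intro k hk
    by_contra hk'
    refine hk ?_
    rcases lt_or_ge 0 k with h | h
    · show fourierCoeff f (-k) * _ = 0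
      rw [hf (-k) (by omega), zero_mul]
    · exact absurd ⟨k.natAbs, by simp only; omega⟩ hk'

theorem integrable_mul (f g : L2T) :
    Integrable (fun t => f t * g t) (AddCircle.haarAddCircle : Measure UnitAddCircle) :=
  (Lp.memLp f).integrable_mul (Lp.memLp g)

theorem fourierCoeff_mul_mul_pow {f g : L2T} (hf : f ∈ H2) (hg : g ∈ H2) (z : ℂ) (n : ℕ) :
    fourierCoeff (fun t => f t * g t) (n : ℤ) * z ^ n =
      ∑ k ∈ Finset.range (n + 1), fourierCoeff f (k : ℤ) * z ^ k *
        (fourierCoeff g ((n - k : ℕ) : ℤ) * z ^ (n - k)) := by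
  rw [fourierCoeff_mul_natCast hf hg, Finset.sum_mul]
  refine Finset.sum_congr rfl fun k hk => ?_
  rw [Finset.mem_range] at hk
  rw [show z ^ n = z ^ k * z ^ (n - k) by rw [← pow_add]; congr 1; omega]
  ring

theorem tsum_fourierCoeff_mul {f g : L2T} (hf : f ∈ H2) (hg : g ∈ H2) {z : ℂ}
    (hz : z ∈ Metric.ball (0 : ℂ) 1) :
    ∑' n : ℕ, fourierCoeff (fun t => f t * g t) (n : ℤ) * z ^ n =
      diskValue f z * diskValue g z := by
  simp only [fourierCoeff_mul_mul_pow hf hg]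
  exact (tsum_mul_tsum_eq_tsum_sum_range_of_summable_norm
    (summable_norm_fourierCoeff_mul_pow f hz) (summable_norm_fourierCoeff_mul_pow g hz)).symm

theorem summable_norm_fourierCoeff_mul {f g : L2T} (hf : f ∈ H2) (hg : g ∈ H2) {z : ℂ}
    (hz : z ∈ Metric.ball (0 : ℂ) 1) :
    Summable fun n : ℕ => ‖fourierCoeff (fun t => f t * g t) (n : ℤ) * z ^ n‖ := by
  simp only [fourierCoeff_mul_mul_pow hf hg]
  have := summable_norm_sum_mul_range_of_summable_norm
    (summable_norm_fourierCoeff_mul_pow f hz) (summable_norm_fourierCoeff_mul_pow g hz)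
  exact this

/-- If `f₁g₁ = f₂g₂` in the disk, then `f₁g₁ = f₂g₂` a.e. on the circle. -/
theorem mul_ae_eq_mul_of_diskValue {f₁ g₁ f₂ g₂ : L2T} (hf₁ : f₁ ∈ H2) (hg₁ : g₁ ∈ H2)
    (hf₂ : f₂ ∈ H2) (hg₂ : g₂ ∈ H2)
    (h : ∀ z ∈ Metric.ball (0 : ℂ) 1,
      diskValue f₁ z * diskValue g₁ z = diskValue f₂ z * diskValue g₂ z) :
    ∀ᵐ t ∂(AddCircle.haarAddCircle : Measure UnitAddCircle), f₁ t * g₁ t = f₂ t * g₂ t := by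
  have hcoeff := eq_of_tsum_mul_pow_eq
    (fun z hz => summable_norm_fourierCoeff_mul hf₁ hg₁ hz)
    (fun z hz => summable_norm_fourierCoeff_mul hf₂ hg₂ hz)
    (fun z hz => by
      rw [tsum_fourierCoeff_mul hf₁ hg₁ hz, tsum_fourierCoeff_mul hf₂ hg₂ hz, h z hz])
  have hall : ∀ n : ℤ, fourierCoeff (fun t => f₁ t * g₁ t) n =
      fourierCoeff (fun t => f₂ t * g₂ t) n := by
    intro n
    rcases lt_or_ge n 0 with hn | hn
    · rw [fourierCoeff_mul_of_neg hf₁ hg₁ hn, fourierCoeff_mul_of_neg hf₂ hg₂ hn]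
    · lift n to ℕ using hn
      exact congrFun hcoeff n
  have i₁ := integrable_mul f₁ g₁
  have i₂ := integrable_mul f₂ g₂
  have h0 : (fun t => f₁ t * g₁ t - f₂ t * g₂ t) =ᵐ[AddCircle.haarAddCircle] 0 := by
    refine ae_eq_zero_of_fourierCoeff_eq_zero (i₁.sub i₂) fun n => ?_
    have := hall n
    simp only [fourierCoeff] at this ⊢
    simp only [smul_sub]
    rw [integral_sub (i₁.fourier_smul _) (i₂.fourier_smul _), this, sub_self]
  filter_upwards [h0] with t ht
  exact sub_eq_zero.1 ht

/-! ### Multiplication by `χⁿ` and the compressed shift -/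

theorem mulChi_mulChi (n m : ℤ) (f : L2T) : mulChi n (mulChi m f) = mulChi (n + m) f := by
  apply Lp.ext
  filter_upwards [coeFn_mulChi n (mulChi m f), coeFn_mulChi m f, coeFn_mulChi (n + m) f]
    with t a b c
  rw [a, b, c, fourier_add, mul_assoc]

theorem mulChi_zero (f : L2T) : mulChi 0 f = f := by
  apply Lp.ext
  filter_upwards [coeFn_mulChi 0 f] with t a
  rw [a, fourier_zero, one_mul]

theorem inner_mulChi_left (n : ℤ) (f g : L2T) :
    inner ℂ (mulChi n f) g = inner ℂ f (mulChi (-n) g) := by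
  rw [L2.inner_def, L2.inner_def]
  refine integral_congr_ae ?_
  filter_upwards [coeFn_mulChi n f, coeFn_mulChi (-n) g] with t a b
  rw [RCLike.inner_apply, RCLike.inner_apply, a, b, map_mul, fourier_neg]
  ring

theorem inner_mulChi_mulChi (n : ℤ) (f g : L2T) :
    inner ℂ (mulChi n f) (mulChi n g) = inner ℂ f g := by
  rw [inner_mulChi_left, mulChi_mulChi, neg_add_cancel, mulChi_zero]

theorem one_mem_H2 : one ∈ H2 := fun n hn => by rw [fourierCoeff_one, if_neg hn.ne]

theorem mulChi_one_mem_H2 {f : L2T} (hf : f ∈ H2) : mulChi 1 f ∈ H2 := fun n hn => by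
  rw [fourierCoeff_mulChi]
  exact hf _ (by omega)

theorem mulChi_neg_one_mem_H2 {f : L2T} (hf : f ∈ H2) (h0 : fourierCoeff f 0 = 0) :
    mulChi (-1) f ∈ H2 := fun n hn => by
  rw [fourierCoeff_mulChi]
  rcases (show n - -1 < 0 ∨ n - -1 = 0 by omega) with h | h
  · exact hf _ h
  · rw [h, h0]

/-- `k = θh` as functions on the circle. -/
def IsMul (θ h k : L2T) : Prop :=
  ∀ᵐ t ∂(AddCircle.haarAddCircle : Measure UnitAddCircle), k t = θ t * h t

theorem IsMul.mulChi {θ h k : L2T} (e : IsMul θ h k) (n : ℤ) :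
    IsMul θ (mulChi n h) (ModelSpaces.mulChi n k) := by
  filter_upwards [e, coeFn_mulChi n h, coeFn_mulChi n k] with t a b c
  rw [b, c, a]
  ring

theorem isMul_one (θ : L2T) : IsMul θ one θ := by
  filter_upwards [coeFn_one] with t a
  rw [a, mul_one]

theorem IsMul.sub_smul {θ h k h' k' : L2T} (e : IsMul θ h k) (e' : IsMul θ h' k') (c : ℂ) :
    IsMul θ (h - c • h') (k - c • k') := by
  filter_upwards [e, e', Lp.coeFn_sub k (c • k'), Lp.coeFn_sub h (c • h'), Lp.coeFn_smul c k',
    Lp.coeFn_smul c h'] with t a b c1 c2 c3 c4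
  rw [c1, c2, Pi.sub_apply, Pi.sub_apply, c3, c4, Pi.smul_apply, Pi.smul_apply, a, b,
    smul_eq_mul, smul_eq_mul]
  ring

theorem IsInner.inner_eq {θ h k h' k' : L2T} (hθ : IsInner θ) (e : IsMul θ h k)
    (e' : IsMul θ h' k') : inner ℂ k k' = inner ℂ h h' := by
  rw [L2.inner_def, L2.inner_def]
  refine integral_congr_ae ?_
  filter_upwards [e, e', hθ.norm_eq_one] with t a b c
  have hc : θ t * (starRingEnd ℂ) (θ t) = 1 := by
    rw [Complex.mul_conj, Complex.normSq_eq_norm_sq, c]; simp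
  simp only [RCLike.inner_apply, a, b, map_mul]
  linear_combination (h' t * (starRingEnd ℂ) (h t)) * hc

theorem inner_one_left (f : L2T) : inner ℂ one f = fourierCoeff f 0 := by
  rw [one, fourierCoeff_eq_inner]

theorem IsInner.inner_self {θ : L2T} (hθ : IsInner θ) : inner ℂ θ θ = (1 : ℂ) := by
  rw [hθ.inner_eq (isMul_one θ) (isMul_one θ), inner_one_left, fourierCoeff_one, if_pos rfl]

/-! ### Model spaces and explicit formulas for the shifts -/

theorem mem_modelSpace {θ f : L2T} :
    f ∈ modelSpace θ ↔ f ∈ H2 ∧ ∀ h ∈ H2, ∀ k, IsMul θ h k → inner ℂ k f = 0 := by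
  refine and_congr Iff.rfl ((Submodule.mem_orthogonal _ _).trans ⟨?_, ?_⟩)
  · exact fun H h hh k e => H k ⟨h, hh, e⟩
  · rintro H k ⟨h, hh, e⟩
    exact H h hh k e

theorem inner_eq_zero_of_mem_modelSpace {θ f : L2T} (hf : f ∈ modelSpace θ) :
    inner ℂ θ f = 0 :=
  (mem_modelSpace.1 hf).2 one one_mem_H2 θ (isMul_one θ)

theorem shift_sub_mem_modelSpace {θ f : L2T} (hθ : IsInner θ) (hf : f ∈ modelSpace θ) :
    mulChi 1 f - (inner ℂ (mulChi (-1) θ) f : ℂ) • θ ∈ modelSpace θ := by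
  rw [mem_modelSpace] at hf ⊢
  refine ⟨H2.sub_mem (mulChi_one_mem_H2 hf.1) (H2.smul_mem _ hθ.mem_H2), fun h hh k e => ?_⟩
  -- Removing the constant term keeps `χ̄(h - h(0))` in `H²`, so `f` is orthogonal to its product
  -- with `θ`. The remaining pairing with `h(0)χ̄θ` is what the correction by `θ` cancels.
  have hmem : mulChi (-1) (h - fourierCoeff h 0 • one) ∈ H2 := by
    refine mulChi_neg_one_mem_H2 (H2.sub_mem hh (H2.smul_mem _ one_mem_H2)) ?_
    rw [fourierCoeff_sub, fourierCoeff_smul, fourierCoeff_one, if_pos rfl, mul_one, sub_self]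
  have h1 := hf.2 _ hmem _ ((e.sub_smul (isMul_one θ) (fourierCoeff h 0)).mulChi (-1))
  rw [map_sub, map_smul, inner_sub_left, inner_smul_left] at h1
  have h2 : inner ℂ k θ = (starRingEnd ℂ) (fourierCoeff h 0) := by
    rw [hθ.inner_eq e (isMul_one θ), ← inner_conj_symm, inner_one_left]
  have h3 : inner ℂ k (mulChi 1 f) = inner ℂ (mulChi (-1) k) f := by
    rw [inner_mulChi_left, neg_neg]
  rw [inner_sub_right, inner_smul_right, h2, h3]
  linear_combination h1

/-- `S_θ f = χf - (f, χ̄θ)θ`. -/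
theorem coe_compressedShift {θ : L2T} (hθ : IsInner θ) (f : modelSpace θ) :
    (compressedShift θ f : L2T) =
      mulChi 1 (f : L2T) - (inner ℂ (mulChi (-1) θ) (f : L2T) : ℂ) • θ := by
  have h1 : (compressedShift θ f : L2T) =
      (modelSpace θ).starProjection (mulChi 1 (f : L2T)) := rfl
  rw [h1]
  -- The candidate lies in `K_θ` and differs from `χf` by a multiple of `θ`, which is orthogonal to
  -- `K_θ`.
  refine Submodule.eq_starProjection_of_mem_of_inner_eq_zero
    (shift_sub_mem_modelSpace hθ f.2) fun w hw => ?_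
  rw [sub_sub_cancel, inner_smul_left, inner_eq_zero_of_mem_modelSpace hw, mul_zero]

theorem coe_perturbedShift {θ : L2T} (hθ : IsInner θ) (h0 : diskValue θ 0 = 0)
    (u f : modelSpace θ) :
    (perturbedShift hθ h0 u f : L2T) = mulChi 1 (f : L2T) +
      (inner ℂ (conjChiElt hθ h0) f : ℂ) • ((u : L2T) - θ) := by
  have h1 : (perturbedShift hθ h0 u f : L2T) = (compressedShift θ f : L2T) +
      (inner ℂ (conjChiElt hθ h0) f : ℂ) • (u : L2T) := rfl
  have h2 : (inner ℂ (conjChiElt hθ h0) f : ℂ) = inner ℂ (mulChi (-1) θ) (f : L2T) := rfl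
  rw [h1, coe_compressedShift hθ, h2, smul_sub]
  abel

theorem clarkUnitary_one {θ : L2T} (hθ : IsInner θ) (h0 : diskValue θ 0 = 0) :
    clarkUnitary hθ h0 1 = perturbedShift hθ h0 (oneElt hθ h0) := by
  rw [clarkUnitary, perturbedShift, Circle.coe_one, one_smul]

/-! ### The Clark unitary operator -/

/-- `f ↦ χ̄(f - f(0)(1 - θ))` maps `K_θ` into itself. -/
theorem backward_mem_modelSpace {θ f : L2T} (hθ : IsInner θ) (h0 : diskValue θ 0 = 0)
    (hf : f ∈ modelSpace θ) :
    mulChi (-1) (f - fourierCoeff f 0 • (one - θ)) ∈ modelSpace θ := by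
  rw [diskValue_zero] at h0
  rw [mem_modelSpace] at hf ⊢
  refine ⟨mulChi_neg_one_mem_H2 (H2.sub_mem hf.1 (H2.smul_mem _ (H2.sub_mem one_mem_H2 hθ.mem_H2)))
    ?_, fun h hh k e => ?_⟩
  · rw [fourierCoeff_sub, fourierCoeff_smul, fourierCoeff_sub, fourierCoeff_one, if_pos rfl, h0]
    ring
  · have hh' := mulChi_one_mem_H2 hh
    have e' := e.mulChi 1
    have h1 := hf.2 _ hh' _ e'
    have h2 : inner ℂ (mulChi 1 k) θ = (0 : ℂ) := by
      rw [hθ.inner_eq e' (isMul_one θ), ← inner_conj_symm, inner_one_left, fourierCoeff_mulChi,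
        hh _ (by norm_num), map_zero]
    have h3 : inner ℂ (mulChi 1 k) one = (0 : ℂ) := by
      have h1mem := one_mem hθ (by rw [diskValue_zero, h0])
      exact (mem_modelSpace.1 h1mem).2 _ hh' _ e'
    have h4 := inner_mulChi_left 1 k (f - fourierCoeff f 0 • (one - θ))
    rw [← h4, inner_sub_right, inner_smul_right, inner_sub_right, h1, h2, h3]
    ring

/-- The preimage of `f` is `χ̄(f - f(0)(1 - θ))`: its pairing with `χ̄θ` is `f(0)`, since `θ` is a
unit vector orthogonal to both `f` and `1`. -/
theorem clarkUnitary_surjective {θ : L2T} (hθ : IsInner θ) (h0 : diskValue θ 0 = 0) :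
    Function.Surjective (clarkUnitary hθ h0 1) := by
  intro f
  refine ⟨⟨_, backward_mem_modelSpace hθ h0 f.2⟩, Subtype.ext ?_⟩
  have hin : (inner ℂ (conjChiElt hθ h0)
      (⟨_, backward_mem_modelSpace hθ h0 f.2⟩ : modelSpace θ) : ℂ) = fourierCoeff (f : L2T) 0 := by
    show inner ℂ (mulChi (-1) θ) (mulChi (-1) _) = _
    have h1 : inner ℂ θ one = (0 : ℂ) := by
      rw [← inner_conj_symm, inner_one_left, ← diskValue_zero, h0, map_zero]
    rw [inner_mulChi_mulChi, inner_sub_right, inner_smul_right, inner_sub_right, hθ.inner_self, h1,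
      inner_eq_zero_of_mem_modelSpace f.2]
    ring
  rw [clarkUnitary_one, coe_perturbedShift, hin]
  show mulChi 1 (mulChi (-1) _) + fourierCoeff (f : L2T) 0 • (one - θ) = _
  rw [mulChi_mulChi, add_neg_cancel, mulChi_zero]
  abel

/-- With `c = (f, χ̄θ)`, one has `Uf = S_θ f + c1` and `χf = S_θ f + cθ`. Both `1` and `θ` are unit
vectors orthogonal to `S_θ f`, so the two norms agree, and multiplication by `χ` is isometric. -/
theorem norm_clarkUnitary_apply {θ : L2T} (hθ : IsInner θ) (h0 : diskValue θ 0 = 0)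
    (f : modelSpace θ) : ‖clarkUnitary hθ h0 1 f‖ = ‖f‖ := by
  have key : (inner ℂ (clarkUnitary hθ h0 1 f : L2T) (clarkUnitary hθ h0 1 f : L2T) : ℂ) =
      inner ℂ (f : L2T) (f : L2T) := by
    have hmem := shift_sub_mem_modelSpace hθ f.2
    have hval : (clarkUnitary hθ h0 1 f : L2T) = (compressedShift θ f : L2T) +
        (inner ℂ (conjChiElt hθ h0) f : ℂ) • one := by
      rw [clarkUnitary_one]; rfl
    have hshift : mulChi 1 (f : L2T) = (compressedShift θ f : L2T) +
        (inner ℂ (conjChiElt hθ h0) f : ℂ) • θ := by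
      rw [coe_compressedShift hθ]
      exact (sub_add_cancel _ _).symm
    have h1 : inner ℂ one (compressedShift θ f : L2T) = (0 : ℂ) := by
      rw [inner_one_left, coe_compressedShift hθ, fourierCoeff_sub, fourierCoeff_smul,
        fourierCoeff_mulChi, f.2.1 _ (by norm_num), ← diskValue_zero, h0, mul_zero, sub_zero]
    have h2 : inner ℂ θ (compressedShift θ f : L2T) = (0 : ℂ) :=
      inner_eq_zero_of_mem_modelSpace (compressedShift θ f).2
    have h1' : inner ℂ (compressedShift θ f : L2T) one = (0 : ℂ) := by
      rw [← inner_conj_symm, h1, map_zero]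
    have h2' : inner ℂ (compressedShift θ f : L2T) θ = (0 : ℂ) := by
      rw [← inner_conj_symm, h2, map_zero]
    have h3 : inner ℂ one one = (1 : ℂ) := by
      rw [inner_one_left, fourierCoeff_one, if_pos rfl]
    rw [← inner_mulChi_mulChi 1 (f : L2T) (f : L2T), hval, hshift]
    simp only [inner_add_left, inner_add_right, inner_smul_left, inner_smul_right, h1, h2, h1',
      h2', h3, hθ.inner_self]
  rw [inner_self_eq_norm_sq_to_K, inner_self_eq_norm_sq_to_K] at key
  have key2 : ‖(clarkUnitary hθ h0 1 f : L2T)‖ ^ 2 = ‖(f : L2T)‖ ^ 2 := by exact_mod_cast key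
  exact (sq_eq_sq₀ (norm_nonneg _) (norm_nonneg _)).1 key2

/-- If `U` is a surjective isometry, then `U - z` is surjective for `|z| < 1`. -/
theorem exists_sub_smul_eq_of_isometry {E : Type*} [NormedAddCommGroup E] [NormedSpace ℂ E]
    [CompleteSpace E] (U : E →L[ℂ] E) (hU : ∀ f, ‖U f‖ = ‖f‖) (hs : Function.Surjective U)
    {z : ℂ} (hz : ‖z‖ < 1) (h : E) : ∃ f, U f - z • f = h := by
  let e : E ≃ₗᵢ[ℂ] E := LinearIsometryEquiv.ofSurjective ⟨U.toLinearMap, hU⟩ hs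
  let V : E →L[ℂ] E := (e.symm.toContinuousLinearEquiv : E →L[ℂ] E)
  have hV : ‖z • V‖ < 1 := by
    refine lt_of_le_of_lt ?_ hz
    rw [norm_smul]
    refine mul_le_of_le_one_right (norm_nonneg _) ?_
    refine V.opNorm_le_bound zero_le_one fun f => ?_
    rw [one_mul]
    exact (e.symm.norm_map f).le
  -- Here `V = U⁻¹` and `U - z = (1 - zV)U`; the first factor is inverted by a Neumann series.
  obtain ⟨w, hw⟩ := isUnit_one_sub_of_norm_lt_one hV
  refine ⟨V ((↑w⁻¹ : E →L[ℂ] E) h), ?_⟩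
  set k := (↑w⁻¹ : E →L[ℂ] E) h with hk
  have h1 : U (V k) = k := e.apply_symm_apply k
  have h2 : (↑w : E →L[ℂ] E) k = h := by
    rw [hk, ← mul_apply_eq_comp, Units.mul_inv]; rfl
  rw [h1, ← h2, hw]
  rfl

theorem clarkUnitary_sub_smul_surjective {θ : L2T} (hθ : IsInner θ) (h0 : diskValue θ 0 = 0)
    {z : ℂ} (hz : z ∈ Metric.ball (0 : ℂ) 1) (h : modelSpace θ) :
    ∃ f, clarkUnitary hθ h0 1 f - z • f = h :=
  exists_sub_smul_eq_of_isometry _ (norm_clarkUnitary_apply hθ h0)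
    (clarkUnitary_surjective hθ h0) (mem_ball_zero_iff.1 hz) h

/-! ### Inner functions do not take the value `1` on a set of positive measure -/

theorem exists_pow {θ : L2T} (hθ : IsInner θ) (n : ℕ) : ∃ p ∈ H2,
    ∀ᵐ t ∂(AddCircle.haarAddCircle : Measure UnitAddCircle), (p : L2T) t = θ t ^ n := by
  induction n with
  | zero => exact ⟨one, one_mem_H2, by simpa using coeFn_one⟩
  | succ n ih =>
    obtain ⟨p, hp, e⟩ := ih
    have hmem : MemLp (fun t => θ t * p t) 2
        (AddCircle.haarAddCircle : Measure UnitAddCircle) := by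
      refine (Lp.memLp p).of_le ((Lp.aestronglyMeasurable θ).mul (Lp.aestronglyMeasurable p)) ?_
      filter_upwards [hθ.norm_eq_one] with t a
      rw [norm_mul, a, one_mul]
    refine ⟨hmem.toLp _, fun k hk => ?_, ?_⟩
    · rw [fourierCoeff_congr_ae hmem.coeFn_toLp, fourierCoeff_mul_of_neg hθ.mem_H2 hp hk]
    · filter_upwards [hmem.coeFn_toLp, e] with t a b
      rw [a, b, pow_succ']

theorem fourierCoeff_pow_zero {θ : L2T} (hθ : IsInner θ) (h0 : diskValue θ 0 = 0) {n : ℕ}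
    (hn : n ≠ 0) : fourierCoeff (fun t => θ t ^ n) 0 = 0 := by
  obtain ⟨m, rfl⟩ := Nat.exists_eq_succ_of_ne_zero hn
  obtain ⟨p, hp, e⟩ := exists_pow hθ m
  have h1 := fourierCoeff_mul_natCast hθ.mem_H2 hp 0
  rw [zero_add, Finset.sum_range_one, Nat.cast_zero, ← diskValue_zero, h0, zero_mul] at h1
  rw [← h1]
  refine congrFun (fourierCoeff_congr_ae ?_) _
  filter_upwards [e] with t a
  rw [a, pow_succ']

/-- As `θⁿ = 1` on `E = {θ = 1}`, the indicator of `E` has the same inner product `m(E)` with every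
member of the orthonormal sequence `θⁿ`. -/
theorem IsInner.ae_ne_one {θ : L2T} (hθ : IsInner θ) (h0 : diskValue θ 0 = 0) :
    ∀ᵐ t ∂(AddCircle.haarAddCircle : Measure UnitAddCircle), θ t ≠ 1 := by
  choose p hp e using exists_pow hθ
  have hlt : ∀ n m : ℕ, n < m → inner ℂ (p n) (p m) = (0 : ℂ) := by
    intro n m hnm
    rw [← fourierCoeff_pow_zero hθ h0 (show m - n ≠ 0 by omega), L2.inner_def, fourierCoeff]
    refine integral_congr_ae ?_
    filter_upwards [e n, e m, hθ.norm_eq_one] with t a b c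
    have hc : θ t * (starRingEnd ℂ) (θ t) = 1 := by
      rw [Complex.mul_conj, Complex.normSq_eq_norm_sq, c]; simp
    rw [RCLike.inner_apply, a, b, neg_zero, fourier_zero, one_smul, map_pow,
      show θ t ^ m = θ t ^ (m - n) * θ t ^ n by rw [← pow_add]; congr 1; omega, mul_assoc,
      ← mul_pow, hc, one_pow, mul_one]
  have hself : ∀ n : ℕ, ‖p n‖ = 1 := by
    intro n
    have : inner ℂ (p n) (p n) = (1 : ℂ) := by
      rw [show (1 : ℂ) = fourierCoeff one 0 by rw [fourierCoeff_one, if_pos rfl], L2.inner_def,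
        fourierCoeff]
      refine integral_congr_ae ?_
      filter_upwards [e n, coeFn_one, hθ.norm_eq_one] with t a b c
      have hc : θ t * (starRingEnd ℂ) (θ t) = 1 := by
        rw [Complex.mul_conj, Complex.normSq_eq_norm_sq, c]; simp
      rw [RCLike.inner_apply, a, b, neg_zero, fourier_zero, one_smul, map_pow, ← mul_pow, hc,
        one_pow]
    rw [inner_self_eq_norm_sq_to_K] at this
    have h2 : ‖p n‖ ^ 2 = 1 := Complex.ofReal_injective (by simpa using this)
    exact (pow_eq_one_iff_of_nonneg (norm_nonneg _) two_ne_zero).1 h2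
  have hon : Orthonormal ℂ p := by
    refine ⟨hself, fun n m hnm => ?_⟩
    rcases lt_or_gt_of_ne hnm with h | h
    · exact hlt n m h
    · show inner ℂ (p n) (p m) = (0 : ℂ)
      rw [← inner_conj_symm, hlt m n h, map_zero]
  -- A strongly measurable representative makes the level set measurable.
  obtain ⟨θ', hm, he⟩ := Lp.aestronglyMeasurable θ
  let E : Set UnitAddCircle := θ' ⁻¹' {1}
  have hE : MeasurableSet E := hm.measurable (measurableSet_singleton 1)
  let v : L2T := indicatorConstLp 2 hE (measure_ne_top _ _) (1 : ℂ)
  have hv : ∀ n, inner ℂ (p n) v = ((AddCircle.haarAddCircle.real E : ℝ) : ℂ) := by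
    intro n
    have h1 : inner ℂ (p n) v = ∫ t, E.indicator (fun _ => (1 : ℂ)) t
        ∂(AddCircle.haarAddCircle : Measure UnitAddCircle) := by
      rw [L2.inner_def]
      refine integral_congr_ae ?_
      filter_upwards [e n, he, indicatorConstLp_coeFn (p := 2) (hs := hE)
        (hμs := measure_ne_top AddCircle.haarAddCircle E) (c := (1 : ℂ))] with t a b c
      rw [RCLike.inner_apply, c, a, b]
      by_cases ht : t ∈ E
      · have : θ' t = 1 := ht
        simp [this, ht]
      · simp [ht]
    rw [h1, integral_indicator_const _ hE]
    simp
  -- Bessel's inequality makes a constant series summable, so the constant is zero.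
  have hsum := hon.inner_products_summable v
  simp only [hv] at hsum
  have hz := (summable_const_iff _).1 hsum
  have hz' : AddCircle.haarAddCircle.real E = 0 := by simpa using hz
  have hnull : AddCircle.haarAddCircle E = 0 := (measureReal_eq_zero_iff).1 hz'
  have hae : ∀ᵐ t ∂(AddCircle.haarAddCircle : Measure UnitAddCircle), t ∉ E :=
    measure_eq_zero_iff_ae_notMem.1 hnull
  filter_upwards [hae, he] with t a b
  rw [b]
  exact a

/-! ### Intertwining operators are multiplications -/

/-- At the point `z` itself `χf - zf` vanishes, so only the rank-one term survives. -/
theorem diskValue_perturbedShift_sub {θ : L2T} (hθ : IsInner θ) (h0 : diskValue θ 0 = 0)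
    (u f : modelSpace θ) {z : ℂ} (hz : z ∈ Metric.ball (0 : ℂ) 1) :
    diskValue (perturbedShift hθ h0 u f - z • f : modelSpace θ) z =
      inner ℂ (conjChiElt hθ h0) f * (diskValue u z - diskValue θ z) := by
  rw [Submodule.coe_sub, Submodule.coe_smul, coe_perturbedShift, diskValue_sub _ _ hz,
    diskValue_add _ _ hz, diskValue_smul, diskValue_smul, diskValue_sub _ _ hz,
    diskValue_mulChi_one f.2.1 hz]
  ring

theorem diskValue_clarkUnitary_sub {θ : L2T} (hθ : IsInner θ) (h0 : diskValue θ 0 = 0)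
    (f : modelSpace θ) {z : ℂ} (hz : z ∈ Metric.ball (0 : ℂ) 1) :
    diskValue (clarkUnitary hθ h0 1 f - z • f : modelSpace θ) z =
      inner ℂ (conjChiElt hθ h0) f * (1 - diskValue θ z) := by
  rw [clarkUnitary_one, diskValue_perturbedShift_sub hθ h0 _ _ hz]
  congr 2
  exact diskValue_one z

/-- If `θ(z) = 1`, every function in the range of `U - z` would vanish at `z`, but the constant `1`
is in that range. -/
theorem diskValue_ne_one {θ : L2T} (hθ : IsInner θ) (h0 : diskValue θ 0 = 0) {z : ℂ}
    (hz : z ∈ Metric.ball (0 : ℂ) 1) : diskValue θ z ≠ 1 := by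
  intro h
  obtain ⟨f, hf⟩ := clarkUnitary_sub_smul_surjective hθ h0 hz (oneElt hθ h0)
  have h1 := diskValue_clarkUnitary_sub hθ h0 f hz
  rw [hf, h, sub_self, mul_zero] at h1
  exact one_ne_zero ((diskValue_one z).symm.trans h1)

theorem one_sub_mul_diskValue_apply {θ ω : L2T} (hθ : IsInner θ) (hω : IsInner ω)
    (hθ0 : diskValue θ 0 = 0) (hω0 : diskValue ω 0 = 0) (u : modelSpace ω)
    (X : modelSpace θ →L[ℂ] modelSpace ω)
    (hX : ContinuousLinearMap.adjoint X (conjChiElt hω hω0) = conjChiElt hθ hθ0)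
    (hXU : ∀ f, X (clarkUnitary hθ hθ0 1 f) = perturbedShift hω hω0 u (X f))
    {z : ℂ} (hz : z ∈ Metric.ball (0 : ℂ) 1) (h : modelSpace θ) :
    (1 - diskValue θ z) * diskValue (X h) z =
      (diskValue u z - diskValue ω z) * diskValue h z := by
  obtain ⟨f, rfl⟩ := clarkUnitary_sub_smul_surjective hθ hθ0 hz h
  have hin : (inner ℂ (conjChiElt hω hω0) (X f) : ℂ) = inner ℂ (conjChiElt hθ hθ0) f := by
    rw [← hX, ContinuousLinearMap.adjoint_inner_left]
  rw [map_sub, map_smul, hXU, diskValue_perturbedShift_sub hω hω0 _ _ hz,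
    diskValue_clarkUnitary_sub hθ hθ0 _ hz, hin]
  ring

end ModelSpaces

end

theorem theorem3p3 (θ ω : ModelSpaces.L2T)
    (hθ : ModelSpaces.IsInner θ) (hω : ModelSpaces.IsInner ω)
    (hθ0 : ModelSpaces.diskValue θ 0 = 0) (hω0 : ModelSpaces.diskValue ω 0 = 0)
    (u : ModelSpaces.modelSpace ω)
    (T : ModelSpaces.modelSpace ω →L[ℂ] ModelSpaces.modelSpace ω)
    (hT : T = ModelSpaces.perturbedShift hω hω0 u)
    (X : ModelSpaces.modelSpace θ →L[ℂ] ModelSpaces.modelSpace ω)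
    (hX : ContinuousLinearMap.adjoint X (ModelSpaces.conjChiElt hω hω0) =
      ModelSpaces.conjChiElt hθ hθ0)
    (hXT : X ∘L ModelSpaces.clarkUnitary hθ hθ0 1 = T ∘L X) :
    -- the quotient `(u - ω) / (1 - θ)` makes sense in the disk and a.e. on the circle
    (∀ z ∈ Metric.ball (0 : ℂ) 1, ModelSpaces.diskValue θ z ≠ 1) ∧
    (∀ᵐ t ∂(AddCircle.haarAddCircle : MeasureTheory.Measure UnitAddCircle), θ t ≠ 1) ∧
    -- and it is (the function in the disk, and the boundary function, of) an element `g` of `K_ω`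
    ∃ g : ModelSpaces.modelSpace ω,
      (∀ z ∈ Metric.ball (0 : ℂ) 1, ModelSpaces.diskValue g z =
        (ModelSpaces.diskValue u z - ModelSpaces.diskValue ω z) /
          (1 - ModelSpaces.diskValue θ z)) ∧
      (∀ᵐ t ∂(AddCircle.haarAddCircle : MeasureTheory.Measure UnitAddCircle),
        (g : ModelSpaces.L2T) t = ((u : ModelSpaces.L2T) t - ω t) / (1 - θ t)) ∧
      -- `X` is multiplication by `g`, on the circle and in the disk
      (∀ f : ModelSpaces.modelSpace θ,
        (∀ᵐ t ∂(AddCircle.haarAddCircle : MeasureTheory.Measure UnitAddCircle),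
          (X f : ModelSpaces.L2T) t = (g : ModelSpaces.L2T) t * (f : ModelSpaces.L2T) t) ∧
        ∀ z ∈ Metric.ball (0 : ℂ) 1, ModelSpaces.diskValue (X f) z =
          ModelSpaces.diskValue g z * ModelSpaces.diskValue f z) ∧
      ModelSpaces.IsMultiplier θ ω g := by
  have hXU : ∀ f : ModelSpaces.modelSpace θ,
      X (ModelSpaces.clarkUnitary hθ hθ0 1 f) = ModelSpaces.perturbedShift hω hω0 u (X f) := by
    intro f
    rw [← hT]
    exact congrArg (fun A => A f) hXT
  have hval : ∀ z ∈ Metric.ball (0 : ℂ) 1, ∀ h,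
      (1 - ModelSpaces.diskValue θ z) * ModelSpaces.diskValue (X h) z =
        (ModelSpaces.diskValue u z - ModelSpaces.diskValue ω z) * ModelSpaces.diskValue h z :=
    fun z hz h => ModelSpaces.one_sub_mul_diskValue_apply hθ hω hθ0 hω0 u X hX hXU hz h
  have hone : ∀ z ∈ Metric.ball (0 : ℂ) 1, ModelSpaces.diskValue θ z ≠ 1 := fun z hz =>
    ModelSpaces.diskValue_ne_one hθ hθ0 hz
  have hae := hθ.ae_ne_one hθ0
  have hcoe : ((ModelSpaces.oneElt hθ hθ0 : ModelSpaces.modelSpace θ) : ModelSpaces.L2T) =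
    ModelSpaces.one := rfl
  have hg : ∀ z ∈ Metric.ball (0 : ℂ) 1,
      ModelSpaces.diskValue (X (ModelSpaces.oneElt hθ hθ0)) z =
        (ModelSpaces.diskValue u z - ModelSpaces.diskValue ω z) /
          (1 - ModelSpaces.diskValue θ z) := by
    intro z hz
    have := hval z hz (ModelSpaces.oneElt hθ hθ0)
    rw [hcoe, ModelSpaces.diskValue_one, mul_one] at this
    rw [eq_div_iff (sub_ne_zero.2 (hone z hz).symm), ← this, mul_comm]
  have hboundary : ∀ h : ModelSpaces.modelSpace θ,
      ∀ᵐ t ∂(AddCircle.haarAddCircle : MeasureTheory.Measure UnitAddCircle),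
        (1 - θ t) * (X h : ModelSpaces.L2T) t =
          ((u : ModelSpaces.L2T) t - ω t) * (h : ModelSpaces.L2T) t := by
    intro h
    -- The identity is transferred before dividing, since it then involves only products of `H²`
    -- functions.
    have := ModelSpaces.mul_ae_eq_mul_of_diskValue
      (ModelSpaces.H2.sub_mem ModelSpaces.one_mem_H2 hθ.mem_H2) (X h).2.1
      (ModelSpaces.H2.sub_mem u.2.1 hω.mem_H2) h.2.1 (fun z hz => by
        rw [ModelSpaces.diskValue_sub _ _ hz, ModelSpaces.diskValue_sub _ _ hz,
          ModelSpaces.diskValue_one]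
        exact hval z hz h)
    filter_upwards [this, MeasureTheory.Lp.coeFn_sub ModelSpaces.one θ,
      MeasureTheory.Lp.coeFn_sub (u : ModelSpaces.L2T) ω, ModelSpaces.coeFn_one] with t a b c d
    rw [b, c, Pi.sub_apply, Pi.sub_apply, d] at a
    exact a
  have hgae : ∀ᵐ t ∂(AddCircle.haarAddCircle : MeasureTheory.Measure UnitAddCircle),
      (X (ModelSpaces.oneElt hθ hθ0) : ModelSpaces.L2T) t =
        ((u : ModelSpaces.L2T) t - ω t) / (1 - θ t) := by
    filter_upwards [hboundary (ModelSpaces.oneElt hθ hθ0), hae, ModelSpaces.coeFn_one]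
      with t a b c
    rw [hcoe, c, mul_one] at a
    rw [eq_div_iff (sub_ne_zero.2 b.symm), ← a, mul_comm]
  have hmul : ∀ f : ModelSpaces.modelSpace θ,
      ∀ᵐ t ∂(AddCircle.haarAddCircle : MeasureTheory.Measure UnitAddCircle),
        (X f : ModelSpaces.L2T) t =
          (X (ModelSpaces.oneElt hθ hθ0) : ModelSpaces.L2T) t * (f : ModelSpaces.L2T) t := by
    intro f
    filter_upwards [hboundary f, hgae, hae] with t a b c
    rw [b, div_mul_eq_mul_div, ← a, mul_div_cancel_left₀ _ (sub_ne_zero.2 c.symm)]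
  -- The witness is `g = X1`, so membership in `K_ω` is automatic.
  refine ⟨hone, hae, X (ModelSpaces.oneElt hθ hθ0), hg, hgae, fun f => ⟨hmul f, fun z hz => ?_⟩,
    (X _).2.1, fun f hf => ⟨X ⟨f, hf⟩, (X _).2, hmul ⟨f, hf⟩⟩⟩
  rw [hg z hz, div_mul_eq_mul_div, ← hval z hz f,
    mul_div_cancel_left₀ _ (sub_ne_zero.2 (hone z hz).symm)]
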